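/- Let $X$ be a standard Borel space and $\mu$ a non-atomic Borel probability measure on $X$. Let $G_{\mathrm{mp}}(X,\mu)$ be the group, under composition, of all Borel bijections $f:X\to X$ that are measure preserving, i.e. $\mu(f^{-1}(A))=\mu(A)$ for all Borel $A\subseteq X$. Let $I_{\mathrm{mp}}(X,\mu)$ be its normal subgroup of all $f\in G_{\mathrm{mp}}(X,\mu)$ with $f(x)=x$ for $\mu$-almost every $x$. Let $\mathrm{Aut}(X,\mu)=G_{\mathrm{mp}}(X,\mu)/I_{\mathrm{mp}}(X,\mu)$, with canonical homomorphism $\bar\varphi:G_{\mathrm{mp}}(X,\mu)\to\mathrm{Aut}(X,\mu)$. Assume the Continuum Hypothesis, $2^{\aleph_0}=\aleph_1$. Then there is a group homomorphism $h:\mathrm{Aut}(X,\mu)\to G_{\mathrm{mp}}(X,\mu)$ such that $\bar\varphi\circ h=\mathrm{id}_{\mathrm{Aut}(X,\mu)}$. -/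

import Mathlib

open MeasureTheory

/-- The group `G_mp(X, μ)` of measure preserving Borel bijections of a standard Borel space
with a measure, under composition. (By the Lusin-Souslin theorem the inverse of a Borel bijection
of a standard Borel space is again Borel, so this is indeed a group.) -/
def Gmp {X : Type*} [MeasurableSpace X] [StandardBorelSpace X] (μ : Measure X) :
    Subgroup (Equiv.Perm X) where
  carrier := {f | MeasurePreserving f μ μ}
  mul_mem' := by
    intro f g hf hg
    exact MeasurePreserving.comp (g := ⇑f) (f := ⇑g) hf hg
  one_mem' := MeasurePreserving.id μ
  inv_mem' := by
    intro f hf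
    have hf' : MeasurePreserving f μ μ := hf
    let e : X ≃ᵐ X :=
      { toEquiv := f
        measurable_toFun := hf'.measurable
        measurable_invFun := fun s hs => by
          rw [← Equiv.image_eq_preimage_symm]
          exact (hf'.measurable.measurableEmbedding f.injective).measurableSet_image' hs }
    have he : MeasurePreserving e μ μ := hf'
    exact MeasurePreserving.symm e he

/-- The subgroup `I_mp(X, μ)` of those `f` in `G_mp(X, μ)` with `f x = x` for `μ`-almost
every `x`. -/
def Imp {X : Type*} [MeasurableSpace X] [StandardBorelSpace X] (μ : Measure X) :
    Subgroup (Gmp μ) where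
  carrier := {f | ∀ᵐ x ∂μ, (f : Equiv.Perm X) x = x}
  mul_mem' := by
    intro f g hf hg
    simp only [Set.mem_ofPred_eq] at hf hg ⊢
    filter_upwards [hg, g.2.quasiMeasurePreserving.ae hf] with x h1 h2
    simp [h1] at h2 ⊢
    exact h2
  one_mem' := by simp
  inv_mem' := by
    intro f hf
    simp only [Set.mem_ofPred_eq] at hf ⊢
    filter_upwards [hf] with x hx
    exact Equiv.Perm.inv_eq_iff_eq.mpr hx.symm

instance Imp.normal {X : Type*} [MeasurableSpace X] [StandardBorelSpace X] (μ : Measure X) :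
    (Imp μ).Normal where
  conj_mem := by
    intro f hf g
    have hf' : ∀ᵐ x ∂μ, (f : Equiv.Perm X) x = x := hf
    have hg : MeasurePreserving ((g⁻¹ : Gmp μ) : Equiv.Perm X) μ μ := (g⁻¹).2
    change ∀ᵐ x ∂μ, ((g * f * g⁻¹ : Gmp μ) : Equiv.Perm X) x = x
    filter_upwards [hg.quasiMeasurePreserving.ae hf'] with x hx
    simp at hx ⊢
    simp [hx]

/-- The group `Aut(X, μ) = G_mp(X, μ) / I_mp(X, μ)` of measure preserving transformations. -/
abbrev AutMp {X : Type*} [MeasurableSpace X] [StandardBorelSpace X] (μ : Measure X) : Type _ :=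
  Gmp μ ⧸ Imp μ

/-- The canonical homomorphism of `G_mp(X, μ)` onto `Aut(X, μ)`. -/
abbrev quotientMap {X : Type*} [MeasurableSpace X] [StandardBorelSpace X] (μ : Measure X) :
    Gmp μ →* AutMp μ :=
  QuotientGroup.mk' (Imp μ)

/-!
Under the continuum hypothesis, `Aut(X, μ)` has at most `ℵ₁` elements, so a lift can be built as
the union of a chain of lifts of countable subgroups, each new element being added at a countable
stage. To extend a lift from a countable group `G` to a countable group `K ⊇ G`, choose measure
preserving representatives of the elements of `K`. Off an invariant null set they form an action
of `K` extending the one already built, so only an action on a null set has to be extended from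
`G` to `K`.

An action of `G` on a standard Borel space extends to `K` as soon as it contains a copy of the
shift of `G` on `(2^ℕ)^G`: the shift of `K` contains the given action and, seen as an action of
`G`, embeds in the shift of `G`, so by an equivariant Cantor-Bernstein argument it is isomorphic
over `G` to the given action.

To have copies of the shift at every stage, a null set is reserved on which maps `act a`, one for
each `a ∈ Aut(X, μ)`, are fixed in advance. The lift of a countable group `G` follows `act` at the
points where `act` obeys the laws of an action of `G`. These points shrink as `G` grows, so the
points needed for `G` but no longer for `K ⊇ G` are free to carry the extension, and `act` is made
so universal that there is a copy of the shift of `G` among them.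
-/

open Cardinal

theorem countable_subgroupClosure {G : Type*} [Group G] {s : Set G} (hs : s.Countable) :
    (Subgroup.closure s : Set G).Countable := by
  have : Countable s := hs
  have : Countable (FreeGroup s) := Quot.mk_surjective.countable
  rw [FreeGroup.closure_eq_range, MonoidHom.coe_range]
  exact Set.countable_range _

theorem exists_section_of_disjoint_ker {G H : Type*} [Group G] [Group H] {φ : G →* H}
    {Γ : Subgroup G} (hΓ : Disjoint Γ φ.ker) :
    ∃ s : Γ.map φ →* G, (∀ x, φ (s x) = x) ∧
      ∀ γ (hγ : γ ∈ Γ), s ⟨φ γ, Subgroup.mem_map_of_mem φ hγ⟩ = γ := by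
  have hinj : Function.Injective (φ.subgroupMap Γ) := by
    refine (injective_iff_map_eq_one _).2 fun γ hγ => ?_
    exact Subtype.ext (Subgroup.disjoint_def.1 hΓ γ.2 (congrArg Subtype.val hγ))
  let e := MulEquiv.ofBijective (φ.subgroupMap Γ) ⟨hinj, φ.subgroupMap_surjective Γ⟩
  exact ⟨Γ.subtype.comp e.symm, fun x => congrArg Subtype.val (e.apply_symm_apply x),
    fun γ hγ => congrArg Subtype.val (e.symm_apply_apply ⟨γ, hγ⟩)⟩

theorem disjoint_sSup_of_directedOn {G : Type*} [Group G] {C : Set (Subgroup G)}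
    (hne : C.Nonempty) (hC : DirectedOn (· ≤ ·) C) {N : Subgroup G} (h : ∀ Γ ∈ C, Disjoint Γ N) :
    Disjoint (sSup C) N := by
  refine Subgroup.disjoint_def.2 fun {γ} hγ hγN => ?_
  obtain ⟨Γ, hΓ, hγΓ⟩ := (Subgroup.mem_sSup_of_directedOn hne hC).1 hγ
  exact Subgroup.disjoint_def.1 (h Γ hΓ) hγΓ hγN

theorem exists_comp_eq_id_of_directedOn {G H : Type*} [Group G] [Group H] {φ : G →* H}
    {C : Set (Subgroup G)} (hC : DirectedOn (· ≤ ·) C) (hker : ∀ Γ ∈ C, Disjoint Γ φ.ker)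
    (hmap : ∀ x, ∃ Γ ∈ C, x ∈ Γ.map φ) : ∃ s : H →* G, φ.comp s = MonoidHom.id H := by
  have hne : C.Nonempty := (hmap 1).imp fun _ h => h.1
  obtain ⟨s, hs, -⟩ := exists_section_of_disjoint_ker (disjoint_sSup_of_directedOn hne hC hker)
  have mem_map (x : H) : x ∈ (sSup C).map φ := by
    obtain ⟨Γ, hΓ, hx⟩ := hmap x
    exact Subgroup.map_mono (le_sSup hΓ) hx
  exact ⟨s.comp ((MonoidHom.id H).codRestrict _ mem_map), MonoidHom.ext fun x => hs _⟩

theorem exists_isChain_inter_nonempty_of_mk_le_aleph_one {A P : Type*} [Preorder P]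
    (hA : #A ≤ ℵ₁)
    (hP : ∀ C : Set P, C.Countable → IsChain (· ≤ ·) C → BddAbove C)
    {D : A → Set P} (hD : ∀ a, IsCofinal (D a)) :
    ∃ C : Set P, IsChain (· ≤ ·) C ∧ ∀ a, (C ∩ D a).Nonempty := by
  have : Nonempty P := (hP ∅ Set.countable_empty (Set.pairwise_empty _)).nonempty
  obtain ⟨r, wo, hr⟩ := exists_ord_eq A
  have countable_initial (a : A) : {b | r b a}.Countable := by
    have h := (card_typein_lt a hr).trans_le hA
    rw [← succ_aleph0, Order.lt_succ_iff] at h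
    exact le_aleph0_iff_set_countable.1 h
  let IsNext (a : A) (F : ∀ b, r b a → P) (q : P) : Prop := q ∈ D a ∧ ∀ b hb, F b hb ≤ q
  let F : A → P := wo.wf.fix fun a ih => Classical.epsilon (IsNext a ih)
  have F_eq (a : A) : F a = Classical.epsilon (IsNext a fun b _ => F b) := wo.wf.fix_eq _ a
  have F_next (a : A) : IsNext a (fun b _ => F b) (F a) := by
    induction a using wo.wf.induction with
    | _ a ih =>
      have hchain : IsChain (· ≤ ·) (F '' {b | r b a}) := by
        rintro _ ⟨b, hb, rfl⟩ _ ⟨c, hc, rfl⟩ hne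
        rcases trichotomous_of r b c with h | rfl | h
        · exact Or.inl ((ih c hc).2 b h)
        · exact absurd rfl hne
        · exact Or.inr ((ih b hb).2 c h)
      obtain ⟨p, hp⟩ := hP _ ((countable_initial a).image F) hchain
      obtain ⟨q, hq, hpq⟩ := hD a p
      rw [F_eq]
      exact Classical.epsilon_spec ⟨q, hq, fun b hb => (hp ⟨b, hb, rfl⟩).trans hpq⟩
  refine ⟨Set.range F, ?_, fun a => ⟨F a, ⟨a, rfl⟩, (F_next a).1⟩⟩
  rintro _ ⟨a, rfl⟩ _ ⟨b, rfl⟩ hne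
  rcases trichotomous_of r a b with h | rfl | h
  · exact Or.inl ((F_next b).2 a h)
  · exact absurd rfl hne
  · exact Or.inr ((F_next a).2 b h)

theorem mk_measurableSet_le_continuum (X : Type*) [MeasurableSpace X]
    [MeasurableSpace.CountablyGenerated X] : #{s : Set X | MeasurableSet s} ≤ 𝔠 := by
  have h := MeasurableSpace.cardinal_measurableSet_le_continuum
    ((MeasurableSpace.countable_countableGeneratingSet (α := X)).le_aleph0.trans
      aleph0_le_continuum)
  rwa [MeasurableSpace.generateFrom_countableGeneratingSet] at h

theorem mk_measurable_le_continuum (X : Type*) [MeasurableSpace X]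
    [StandardBorelSpace X] : #{f : X → X | Measurable f} ≤ 𝔠 := by
  let preimages (f : {f : X → X | Measurable f}) (n : ℕ) : {s : Set X | MeasurableSet s} :=
    ⟨f.1 ⁻¹' MeasurableSpace.natGeneratingSequence X n,
      f.2 (MeasurableSpace.measurableSet_natGeneratingSequence n)⟩
  have hinj : Function.Injective preimages := by
    refine fun f g h => Subtype.ext (funext fun x => ?_)
    refine MeasurableSpace.injective_mapNatBool X (funext fun n => ?_)
    simpa [MeasurableSpace.mapNatBool, preimages] using
      Set.ext_iff.1 (congrArg Subtype.val (congrFun h n)) x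
  calc #{f : X → X | Measurable f} ≤ #(ℕ → {s : Set X | MeasurableSet s}) :=
        mk_le_of_injective hinj
    _ = #{s : Set X | MeasurableSet s} ^ ℵ₀ := by simp
    _ ≤ 𝔠 ^ ℵ₀ := power_le_power_right (mk_measurableSet_le_continuum X)
    _ = 𝔠 := continuum_power_aleph0

theorem measurable_apply_of_countable {Z N B : Type*} [MeasurableSpace Z] [MeasurableSpace N]
    [MeasurableSpace B] [Countable N] [MeasurableSingletonClass N] {F : Z → N → B}
    (hF : ∀ n, Measurable fun z => F z n) {m : Z → N} (hm : Measurable m) :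
    Measurable fun z => F z (m z) :=
  (measurable_from_prod_countable_left (f := fun p : Z × N => F p.1 p.2) hF).comp
    (measurable_id.prodMk hm)

theorem measurable_sInf_nat {Z : Type*} [MeasurableSpace Z] {s : Z → Set ℕ}
    (hs : ∀ n, MeasurableSet {z | n ∈ s z}) : Measurable fun z => sInf (s z) := by
  classical
  have hex (z : Z) : ∃ n, n ∈ s z ∨ s z = ∅ := by
    rcases (s z).eq_empty_or_nonempty with h | ⟨n, hn⟩
    · exact ⟨0, Or.inr h⟩
    · exact ⟨n, Or.inl hn⟩
  have sInf_eq : (fun z => sInf (s z)) = fun z => Nat.find (hex z) := by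
    ext z
    rcases (s z).eq_empty_or_nonempty with h | h
    · exact (congrArg sInf h).trans
        (Nat.sInf_empty.trans ((Nat.find_eq_zero _).2 (Or.inr h)).symm)
    · simp [Nat.sInf_def h, h.ne_empty]
  have measurableSet_empty : MeasurableSet {z | s z = ∅} := by
    simp only [Set.eq_empty_iff_forall_notMem, Set.ofPred_forall]
    exact .iInter fun n => (hs n).compl
  rw [sInf_eq]
  exact measurable_find hex fun n => (hs n).union measurableSet_empty

/-- Codes for functions with values in `B` on a countable set of points of the Cantor space: a
sequence of points, each with the value to be taken there. -/
abbrev InterpolationCode (B : Type*) : Type _ := ℕ → (ℕ → Bool) × B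

/-- The function coded by `z`; a point that occurs nowhere in `z` gets the value of the
first entry of `z`. -/
noncomputable def interpolate {B : Type*} (z : InterpolationCode B) (x : ℕ → Bool) : B :=
  (z (sInf {n | (z n).1 = x})).2

theorem measurable_interpolate {B : Type*} [MeasurableSpace B] (x : ℕ → Bool) :
    Measurable fun z : InterpolationCode B => interpolate z x := by
  refine measurable_apply_of_countable (F := fun (z : InterpolationCode B) n => (z n).2)
    (fun n => by fun_prop) (measurable_sInf_nat fun n => ?_)
  exact (measurable_fst.comp (measurable_pi_apply n)) (measurableSet_singleton x)

theorem exists_interpolate_eq {A B : Type*} [Nonempty B] {c : A → ℕ → Bool}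
    (hc : Function.Injective c) {S : Set A} (hS : S.Countable) (f : A → B) :
    ∃ z : InterpolationCode B, ∀ a ∈ S, interpolate z (c a) = f a := by
  rcases S.eq_empty_or_nonempty with rfl | hne
  · exact ⟨Classical.arbitrary _, fun _ ha => ha.elim⟩
  obtain ⟨x, rfl⟩ := hS.exists_eq_range hne
  refine ⟨fun n => (c (x n), f (x n)), ?_⟩
  rintro _ ⟨n, rfl⟩
  have hmem : sInf {m | c (x m) = c (x n)} ∈ {m | c (x m) = c (x n)} := Nat.sInf_mem ⟨n, rfl⟩
  exact congrArg f (hc hmem)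

/-- An equivariant Borel embedding of the action `a` into the action `b`. -/
structure IsActionEmbedding {G A B : Type*} [Group G] [MeasurableSpace A] [MeasurableSpace B]
    (a : G →* Equiv.Perm A) (b : G →* Equiv.Perm B) (f : A → B) : Prop where
  measurableEmbedding : MeasurableEmbedding f
  semiconj : ∀ g, Function.Semiconj f (a g) (b g)

namespace IsActionEmbedding

variable {G A B C : Type*} [Group G] [MeasurableSpace A] [MeasurableSpace B] [MeasurableSpace C]
  {a : G →* Equiv.Perm A} {b : G →* Equiv.Perm B} {c : G →* Equiv.Perm C} {f : A → B} {g : B → C}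

theorem comp (hg : IsActionEmbedding b c g) (hf : IsActionEmbedding a b f) :
    IsActionEmbedding a c (g ∘ f) :=
  ⟨hg.measurableEmbedding.comp hf.measurableEmbedding,
    fun i => (hg.semiconj i).comp_left (hf.semiconj i)⟩

theorem apply_mem_range_iff (hf : IsActionEmbedding a b f) (i : G) {y : B} :
    b i y ∈ Set.range f ↔ y ∈ Set.range f := by
  have of_mem (i : G) {y : B} (hy : y ∈ Set.range f) : b i y ∈ Set.range f := by
    obtain ⟨x, rfl⟩ := hy
    exact ⟨a i x, hf.semiconj i x⟩
  exact ⟨fun h => by simpa using of_mem i⁻¹ h, of_mem i⟩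

end IsActionEmbedding

section CantorBernstein

variable {A B : Type*} {f : A → B} {g : B → A}

/-- The points of `A` whose backward orbit under `g ∘ f` leaves the range of `g`: the set on
which the Cantor-Bernstein bijection of `f` and `g` follows `f`. -/
def cantorBernsteinSet (f : A → B) (g : B → A) : Set A :=
  ⋃ n : ℕ, (g ∘ f)^[n] '' (Set.range g)ᶜ

theorem cantorBernsteinSet_eq (f : A → B) (g : B → A) :
    cantorBernsteinSet f g = (Set.range g)ᶜ ∪ g '' (f '' cantorBernsteinSet f g) := by
  rw [← Set.image_comp]
  conv_lhs => rw [cantorBernsteinSet, ← Set.union_iUnion_nat_succ]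
  rw [cantorBernsteinSet, Set.image_iUnion]
  simp only [Function.iterate_succ', Function.iterate_zero, Set.image_id, Set.image_comp]

theorem compl_cantorBernsteinSet (f : A → B) {g : B → A} (hg : Function.Injective g) :
    (cantorBernsteinSet f g)ᶜ = g '' (f '' cantorBernsteinSet f g)ᶜ := by
  rw [Set.image_compl_eq_range_sdiff_image hg]
  conv_lhs => rw [cantorBernsteinSet_eq]
  rw [Set.compl_union, compl_compl, Set.sdiff_eq]

theorem apply_mem_cantorBernsteinSet {σ : A → A} {τ : B → B} (hf : Function.Semiconj f σ τ)
    (hg : Function.Semiconj g τ σ) (hσ : ∀ x, σ x ∈ Set.range g → x ∈ Set.range g) {x : A}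
    (hx : x ∈ cantorBernsteinSet f g) : σ x ∈ cantorBernsteinSet f g := by
  obtain ⟨n, y, hy, rfl⟩ := Set.mem_iUnion.1 hx
  have hgf : Function.Commute (g ∘ f) σ := hg.comp_left hf
  exact Set.mem_iUnion.2 ⟨n, σ y, fun h => hy (hσ y h), (hgf.iterate_left n) y⟩

variable [MeasurableSpace A] [MeasurableSpace B]

theorem measurableSet_cantorBernsteinSet (hf : MeasurableEmbedding f)
    (hg : MeasurableEmbedding g) : MeasurableSet (cantorBernsteinSet f g) := by
  have iterate (n : ℕ) : MeasurableEmbedding (g ∘ f)^[n] := by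
    induction n with
    | zero => exact .id
    | succ n ih => exact ih.comp (hg.comp hf)
  exact .iUnion fun n => (iterate n).measurableSet_image' hg.measurableSet_range.compl

end CantorBernstein

theorem bijective_piecewise_of_compl_eq {A B : Type*} {f : A → B} {g : B → A} {g' : A → B}
    (hf : Function.Injective f) (hg : Function.LeftInverse g' g) {S : Set A}
    [∀ x, Decidable (x ∈ S)] (hS : Sᶜ = g '' (f '' S)ᶜ) :
    Function.Bijective (S.piecewise f g') := by
  have image_compl : g' '' Sᶜ = (f '' S)ᶜ := by rw [hS, hg.image_image]
  refine ⟨(Set.injective_piecewise_iff _).2 ⟨hf.injOn, ?_, fun x hx y hy hxy => ?_⟩, ?_⟩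
  · rw [hS]
    exact Set.LeftInvOn.injOn (f₁' := g) (Set.forall_mem_image.2 fun y _ => congrArg g (hg y))
  · have hy' : g' y ∈ (f '' S)ᶜ := image_compl ▸ Set.mem_image_of_mem g' hy
    exact hy' ⟨x, hx, hxy⟩
  · rw [← Set.range_eq_univ, Set.range_piecewise, image_compl, Set.union_compl_self]

theorem exists_measurableEquiv_of_bijective {A B : Type*} [MeasurableSpace A]
    [StandardBorelSpace A] [MeasurableSpace B] [MeasurableSpace.CountablySeparated B] {f : A → B}
    (hf : Measurable f) (hbij : Function.Bijective f) : ∃ e : A ≃ᵐ B, ⇑e = f := by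
  refine ⟨⟨Equiv.ofBijective f hbij, hf, fun s hs => ?_⟩, rfl⟩
  rw [← Equiv.image_eq_preimage_symm]
  exact (hf.measurableEmbedding hbij.injective).measurableSet_image' hs

theorem exists_equivariant_measurableEquiv {G A B : Type*} [Group G] [MeasurableSpace A]
    [StandardBorelSpace A] [MeasurableSpace B] [MeasurableSpace.CountablySeparated B]
    {a : G →* Equiv.Perm A} {b : G →* Equiv.Perm B} {f : A → B} {g : B → A}
    (hf : IsActionEmbedding a b f) (hg : IsActionEmbedding b a g) :
    ∃ e : A ≃ᵐ B, ∀ i, Function.Semiconj e (a i) (b i) := by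
  classical
  rcases isEmpty_or_nonempty B with hB | hB
  · have : IsEmpty A := ⟨fun x => hB.elim (f x)⟩
    exact ⟨⟨Equiv.equivOfIsEmpty A B, measurable_of_empty _, measurable_of_empty _⟩,
      fun _ x => this.elim x⟩
  let S := cantorBernsteinSet f g
  have hgi := hg.measurableEmbedding.leftInverse_invFun
  obtain ⟨e, he⟩ := exists_measurableEquiv_of_bijective
    (hf.measurableEmbedding.measurable.piecewise
      (measurableSet_cantorBernsteinSet hf.measurableEmbedding hg.measurableEmbedding)
      hg.measurableEmbedding.measurable_invFun)
    (bijective_piecewise_of_compl_eq hf.measurableEmbedding.injective hgi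
      (compl_cantorBernsteinSet f hgi.injective))
  have e_of_mem {x : A} (hx : x ∈ S) : e x = f x := by rw [he, Set.piecewise_eq_of_mem _ _ _ hx]
  have e_of_notMem {y : B} (hy : g y ∉ S) : e (g y) = y := by
    rw [he, Set.piecewise_eq_of_notMem _ _ _ hy, hgi y]
  have mem_of_mem (i : G) {x : A} (hx : x ∈ S) : a i x ∈ S :=
    apply_mem_cantorBernsteinSet (hf.semiconj i) (hg.semiconj i)
      (fun _ => (hg.apply_mem_range_iff i).1) hx
  refine ⟨e, fun i x => ?_⟩
  by_cases hx : x ∈ S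
  · rw [e_of_mem hx, e_of_mem (mem_of_mem i hx), hf.semiconj i x]
  · have hix : a i x ∉ S := fun h => hx (by simpa using mem_of_mem i⁻¹ h)
    obtain ⟨y, -, rfl⟩ := (compl_cantorBernsteinSet f hgi.injective).subset hx
    rw [e_of_notMem hx, ← hg.semiconj i y]
    exact e_of_notMem (by rwa [hg.semiconj i y])

/-- The shift action of a group `G` on the functions from `G` to `C`. -/
def shift (G C : Type*) [Group G] : G →* Equiv.Perm (G → C) :=
  @MulAction.toPermHom G (G → C) _ arrowAction

theorem shift_apply {G C : Type*} [Group G] (g h : G) (t : G → C) :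
    shift G C g t h = t (g⁻¹ * h) :=
  rfl

theorem measurable_shift {G C : Type*} [Group G] [MeasurableSpace C] (g : G) :
    Measurable (shift G C g) :=
  measurable_pi_iff.2 fun h => measurable_pi_apply (g⁻¹ * h)

section ExtendAction

variable {G K : Type*} [Group G] [Group K] [Countable K] {j : G →* K}

theorem exists_isActionEmbedding_shift {W : Type*} [MeasurableSpace W] [StandardBorelSpace W]
    (hj : Function.Injective j) {a : G →* Equiv.Perm W} (ha : ∀ g, Measurable (a g)) :
    ∃ F : W → K → ℕ → Bool, IsActionEmbedding a ((shift K (ℕ → Bool)).comp j) F := by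
  let φ := MeasurableSpace.mapNatBool W
  let F (w : W) : K → ℕ → Bool := Function.extend j (fun g => φ (a g⁻¹ w)) fun _ _ => false
  have F_apply (w : W) (g : G) : F w (j g) = φ (a g⁻¹ w) := hj.extend_apply _ _ _
  have F_of_notMem (w : W) {k : K} (hk : ¬∃ g, j g = k) : F w k = fun _ => false :=
    Function.extend_apply' _ _ _ hk
  refine ⟨F, Measurable.measurableEmbedding (measurable_pi_iff.2 fun k => ?_) fun v w h => ?_,
    fun g w => funext fun k => ?_⟩
  · by_cases hk : ∃ g, j g = k
    · obtain ⟨g, rfl⟩ := hk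
      simp only [F_apply]
      exact (MeasurableSpace.measurable_mapNatBool W).comp (ha _)
    · simp only [F_of_notMem _ hk, measurable_const]
  · have h1 := congrFun h (j 1)
    rw [F_apply, F_apply] at h1
    simpa using MeasurableSpace.injective_mapNatBool W h1
  · rw [MonoidHom.comp_apply, shift_apply]
    by_cases hk : ∃ i, j i = k
    · obtain ⟨i, rfl⟩ := hk
      rw [← map_inv, ← map_mul, F_apply, F_apply]
      simp
    · rw [F_of_notMem _ hk, F_of_notMem]
      rintro ⟨i, hi⟩
      exact hk ⟨g * i, by rw [map_mul, hi, mul_inv_cancel_left]⟩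

theorem exists_extend_action {Y : Type*} [MeasurableSpace Y] [StandardBorelSpace Y]
    (hj : Function.Injective j) {a : G →* Equiv.Perm Y} (ha : ∀ g, Measurable (a g))
    {u : (G → ℕ → Bool) → Y} (hu : IsActionEmbedding (shift G (ℕ → Bool)) a u) :
    ∃ b : K →* Equiv.Perm Y, (∀ k, Measurable (b k)) ∧ b.comp j = a := by
  have : Countable G := hj.countable
  let s := shift K (ℕ → Bool)
  obtain ⟨F, hF⟩ := exists_isActionEmbedding_shift hj ha
  obtain ⟨F', hF'⟩ := exists_isActionEmbedding_shift (j := MonoidHom.id G) Function.injective_id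
    (a := s.comp j) fun g => measurable_shift (j g)
  obtain ⟨e, he⟩ := exists_equivariant_measurableEquiv hF (hu.comp hF')
  refine ⟨e.toEquiv.symm.permCongrHom.toMonoidHom.comp s, fun k => ?_, ?_⟩
  · exact e.symm.measurable.comp ((measurable_shift k).comp e.measurable)
  · ext g y
    exact e.symm_apply_eq.2 (he g y).symm

end ExtendAction

/-- The restriction of an action to an invariant set. -/
def restrictAction {G A : Type*} [Group G] (a : G →* Equiv.Perm A) (s : Set A)
    (hs : ∀ g x, a g x ∈ s ↔ x ∈ s) : G →* Equiv.Perm s where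
  toFun g := (a g).subtypePerm (hs g)
  map_one' := by ext; simp
  map_mul' g h := by
    ext x
    exact congrArg (fun e : Equiv.Perm A => e x) (map_mul a g h)

theorem exists_glued_action {K L T : Type*} [Group K] [MeasurableSpace L] [MeasurableSpace T]
    {v : L → T} (hv : MeasurableEmbedding v) {l : K →* Equiv.Perm L} (hl : ∀ k, Measurable (l k))
    {c : K →* Equiv.Perm ((Set.range v)ᶜ : Set T)} (hc : ∀ k, Measurable (c k)) :
    ∃ b : K →* Equiv.Perm T, (∀ k, Measurable (b k)) ∧ (∀ k, Function.Semiconj v (l k) (b k)) ∧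
      ∀ k, Function.Semiconj (↑) (c k) (b k) := by
  classical
  let e : L ⊕ ((Set.range v)ᶜ : Set T) ≃ᵐ T :=
    (hv.equivRange.sumCongr (.refl _)).trans (.sumCompl hv.measurableSet_range)
  let b : K →* Equiv.Perm T :=
    e.toEquiv.permCongrHom.toMonoidHom.comp ((Equiv.Perm.sumCongrHom _ _).comp (l.prod c))
  have b_apply (k : K) (x) : b k (e x) = e (Sum.map (l k) (c k) x) :=
    congrArg (fun y => e (Sum.map (l k) (c k) y)) (e.symm_apply_apply x)
  have e_inl (x : L) : e (Sum.inl x) = v x := congrArg Subtype.val (hv.equivRange_apply x)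
  refine ⟨b, fun k => ?_, fun k x => ?_, fun k y => (b_apply k (Sum.inr y)).symm⟩
  · exact e.measurable.comp (((hl k).sumMap (hc k)).comp e.symm.measurable)
  · rw [← e_inl, ← e_inl, b_apply, Sum.map_inl]

theorem exists_extend_action_of_embedding {G K L T : Type*} [Group G] [Group K] [Countable K]
    [MeasurableSpace L] [MeasurableSpace T] [StandardBorelSpace T]
    {j : G →* K} (hj : Function.Injective j) {a : G →* Equiv.Perm T}
    (ha : ∀ g, Measurable (a g)) {l : K →* Equiv.Perm L} (hl : ∀ k, Measurable (l k))
    {v : L → T} (hv : IsActionEmbedding (l.comp j) a v)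
    {u : (G → ℕ → Bool) → T} (hu : IsActionEmbedding (shift G (ℕ → Bool)) a u)
    (huv : Disjoint (Set.range u) (Set.range v)) :
    ∃ b : K →* Equiv.Perm T, (∀ k, Measurable (b k)) ∧ b.comp j = a ∧
      ∀ k, Function.Semiconj v (l k) (b k) := by
  have : Countable G := hj.countable
  let s : Set T := (Set.range v)ᶜ
  have hs : MeasurableSet s := hv.measurableEmbedding.measurableSet_range.compl
  have : StandardBorelSpace s := hs.standardBorel
  let a' := restrictAction a s fun g x => not_congr (hv.apply_mem_range_iff g)
  have hus (t) : u t ∈ s := Set.disjoint_left.1 huv ⟨t, rfl⟩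
  have hu' : IsActionEmbedding (shift G (ℕ → Bool)) a' fun t => ⟨u t, hus t⟩ :=
    ⟨hu.measurableEmbedding.measurable.subtype_mk.measurableEmbedding
      fun _ _ h => hu.measurableEmbedding.injective (congrArg Subtype.val h),
      fun g t => Subtype.ext (hu.semiconj g t)⟩
  obtain ⟨c, hc, hca⟩ := exists_extend_action hj
    (fun g => ((ha g).comp measurable_subtype_coe).subtype_mk) hu'
  obtain ⟨b, hb, hbv, hbc⟩ := exists_glued_action hv.measurableEmbedding hl hc
  refine ⟨b, hb, ?_, hbv⟩
  ext g x
  by_cases hx : x ∈ Set.range v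
  · obtain ⟨y, rfl⟩ := hx
    exact (hbv (j g) y).symm.trans (hv.semiconj g y)
  · have hcg : c (j g) = a' g := DFunLike.congr_fun hca g
    exact (hbc (j g) ⟨x, hx⟩).symm.trans (by rw [hcg]; rfl)

theorem measurableEmbedding_sumElim {A B T : Type*} [MeasurableSpace A] [MeasurableSpace B]
    [MeasurableSpace T] {f : A → T} {g : B → T} (hf : MeasurableEmbedding f)
    (hg : MeasurableEmbedding g) (hfg : Disjoint (Set.range f) (Set.range g)) :
    MeasurableEmbedding (Sum.elim f g) where
  injective := hf.injective.sumElim hg.injective fun a b h =>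
    Set.disjoint_left.1 hfg ⟨a, rfl⟩ ⟨b, h.symm⟩
  measurable := hf.measurable.sumElim hg.measurable
  measurableSet_image' s hs := by
    have image_eq : Sum.elim f g '' s = f '' (Sum.inl ⁻¹' s) ∪ g '' (Sum.inr ⁻¹' s) := by
      ext
      simp
    rw [image_eq]
    exact (hf.measurableSet_image' (measurable_inl hs)).union
      (hg.measurableSet_image' (measurable_inr hs))

theorem isActionEmbedding_sumElim {G A B T : Type*} [Group G] [MeasurableSpace A]
    [MeasurableSpace B] [MeasurableSpace T] {a : G →* Equiv.Perm A} {b : G →* Equiv.Perm B}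
    {c : G →* Equiv.Perm T} {f : A → T} {g : B → T} (hf : IsActionEmbedding a c f)
    (hg : IsActionEmbedding b c g) (hfg : Disjoint (Set.range f) (Set.range g)) :
    IsActionEmbedding ((Equiv.Perm.sumCongrHom A B).comp (a.prod b)) c (Sum.elim f g) where
  measurableEmbedding :=
    measurableEmbedding_sumElim hf.measurableEmbedding hg.measurableEmbedding hfg
  semiconj i := by
    rintro (x | y)
    · exact hf.semiconj i x
    · exact hg.semiconj i y

theorem exists_extend_action_of_disjoint_embeddings {G K A B T : Type*} [Group G] [Group K]
    [Countable K] [MeasurableSpace A] [MeasurableSpace B] [MeasurableSpace T]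
    [StandardBorelSpace T] {j : G →* K} (hj : Function.Injective j) {a : G →* Equiv.Perm T}
    (ha : ∀ g, Measurable (a g)) {l : K →* Equiv.Perm A} (hl : ∀ k, Measurable (l k))
    {m : K →* Equiv.Perm B} (hm : ∀ k, Measurable (m k))
    {v : A → T} (hv : IsActionEmbedding (l.comp j) a v)
    {w : B → T} (hw : IsActionEmbedding (m.comp j) a w)
    {u : (G → ℕ → Bool) → T} (hu : IsActionEmbedding (shift G (ℕ → Bool)) a u)
    (hvw : Disjoint (Set.range v) (Set.range w)) (huv : Disjoint (Set.range u) (Set.range v))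
    (huw : Disjoint (Set.range u) (Set.range w)) :
    ∃ b : K →* Equiv.Perm T, (∀ k, Measurable (b k)) ∧ b.comp j = a ∧
      (∀ k, Function.Semiconj v (l k) (b k)) ∧ ∀ k, Function.Semiconj w (m k) (b k) := by
  have huvw : Disjoint (Set.range u) (Set.range (Sum.elim v w)) := by
    rw [Set.Sum.elim_range]
    exact Set.disjoint_union_right.2 ⟨huv, huw⟩
  obtain ⟨b, hb, hba, hbvw⟩ := exists_extend_action_of_embedding hj ha
    (l := (Equiv.Perm.sumCongrHom A B).comp (l.prod m)) (fun k => (hl k).sumMap (hm k))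
    (isActionEmbedding_sumElim hv hw hvw) hu huvw
  exact ⟨b, hb, hba, fun k x => hbvw k (Sum.inl x), fun k y => hbvw k (Sum.inr y)⟩

section PartialAction

variable {A R : Type*} [Group A] {act : A → R → R} {G K : Subgroup A}

/-- For maps `act a` that need not satisfy the laws of an action of `A`, the set of points where
the laws hold for the subgroup `G`. -/
def actionLocus (act : A → R → R) (G : Subgroup A) : Set R :=
  {r | act 1 r = r ∧ ∀ g ∈ G, ∀ h ∈ G, act (g * h) r = act g (act h r)}

theorem actionLocus_anti (act : A → R → R) : Antitone (actionLocus act) :=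
  fun _ _ hGK _ hr => ⟨hr.1, fun g hg h hh => hr.2 g (hGK hg) h (hGK hh)⟩

theorem apply_mem_actionLocus {r : R} (hr : r ∈ actionLocus act G) {k : A} (hk : k ∈ G) :
    act k r ∈ actionLocus act G := by
  refine ⟨by rw [← hr.2 1 G.one_mem k hk, one_mul], fun g hg h hh => ?_⟩
  rw [← hr.2 _ (G.mul_mem hg hh) k hk, mul_assoc, hr.2 g hg _ (G.mul_mem hh hk), hr.2 h hh k hk]

theorem measurableSet_actionLocus [MeasurableSpace R] [MeasurableEq R]
    [Countable G] (hact : ∀ a, Measurable (act a)) : MeasurableSet (actionLocus act G) := by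
  have eq_iInter : actionLocus act G =
      {r | act 1 r = r} ∩ ⋂ (g : G) (h : G), {r | act (g * h) r = act g (act h r)} := by
    ext r
    simp [actionLocus]
  rw [eq_iInter]
  exact (measurableSet_eq_fun (hact 1) measurable_id).inter <| .iInter fun g => .iInter fun h =>
    measurableSet_eq_fun (hact _) ((hact _).comp (hact _))

/-- The action of `G` on the set of points where its laws hold. -/
def locusHom (act : A → R → R) (G : Subgroup A) : G →* Equiv.Perm (actionLocus act G) :=
  MonoidHom.toHomPerm
    { toFun g := fun r => ⟨act g r, apply_mem_actionLocus r.2 g.2⟩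
      map_one' := funext fun r => Subtype.ext r.2.1
      map_mul' g h := funext fun r => Subtype.ext (r.2.2 g g.2 h h.2) }

/-- Borel maps `act a` which, over every countable subgroup `G`, act on some copy of the shift of
`G` that can be chosen apart from the points where the laws hold for a given subgroup
`K` not contained in `G`. -/
structure IsUniversalPartialAction [MeasurableSpace R] (act : A → R → R) : Prop where
  measurable : ∀ a, Measurable (act a)
  exists_embedding : ∀ G K : Subgroup A, Countable G → ¬K ≤ G →
    ∃ u : (G → ℕ → Bool) → actionLocus act G,
      IsActionEmbedding (shift G (ℕ → Bool)) (locusHom act G) u ∧ ∀ t, ↑(u t) ∉ actionLocus act K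

end PartialAction

section Reindex

/-- A sequence together with a code for a family of self-maps of its index set. The sequences have
entries in `ℕ × (ℕ → Bool)`; the first components keep the sequences in use from being constant. -/
abbrev ReindexSpace : Type := InterpolationCode (ℕ → ℕ) × (ℕ → ℕ × (ℕ → Bool))

/-- The map which reindexes a sequence by the self-map of `ℕ` that its code assigns to the
point `c a`. -/
noncomputable def reindex {A : Type*} (c : A → ℕ → Bool) (a : A) (r : ReindexSpace) :
    ReindexSpace :=
  (r.1, r.2 ∘ interpolate r.1 (c a))

theorem measurable_reindex {A : Type*} (c : A → ℕ → Bool) (a : A) : Measurable (reindex c a) := by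
  refine measurable_fst.prodMk (measurable_pi_iff.2 fun n => ?_)
  exact measurable_apply_of_countable (F := fun r : ReindexSpace => r.2) (fun n => by fun_prop)
    ((measurable_pi_apply n).comp ((measurable_interpolate (c a)).comp measurable_fst))

variable {A : Type*} [Group A] {c : A → ℕ → Bool} {G K : Subgroup A}

theorem eq_const_of_mem_actionLocus_reindex {r : ReindexSpace}
    (hr : r ∈ actionLocus (reindex c) K) {k : A} (hk : k ∈ K) (hkr : interpolate r.1 (c k) = 0)
    (n : ℕ) : r.2 n = r.2 0 := by
  have hmul := hr.2 k⁻¹ (K.inv_mem hk) k hk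
  rw [inv_mul_cancel, hr.1] at hmul
  calc r.2 n = r.2 (interpolate r.1 (c k) (interpolate r.1 (c k⁻¹) n)) :=
        congrFun (congrArg Prod.snd hmul) n
    _ = r.2 0 := by rw [hkr, Pi.zero_apply]

/-- The sequence that lists the values of `t`, each of them infinitely often and marked with
natural numbers, along an enumeration `e`. -/
def listing {I : Type*} (e : ℕ ≃ I × ℕ) (z : InterpolationCode (ℕ → ℕ)) (t : I → ℕ → Bool) :
    ReindexSpace :=
  (z, fun n => ((e n).2, t (e n).1))

theorem measurableEmbedding_listing {I : Type*} [Countable I] (e : ℕ ≃ I × ℕ)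
    (z : InterpolationCode (ℕ → ℕ)) : MeasurableEmbedding (listing e z) := by
  refine Measurable.measurableEmbedding ?_ fun t t' h => funext fun i => ?_
  · unfold listing
    fun_prop
  · simpa [listing] using congrFun (congrArg Prod.snd h) (e.symm (i, 0))

theorem not_forall_listing_eq {I : Type*} [Nonempty I] (e : ℕ ≃ I × ℕ)
    (z : InterpolationCode (ℕ → ℕ)) (t : I → ℕ → Bool) :
    ¬∀ n, (listing e z t).2 n = (listing e z t).2 0 := by
  intro h
  let i : I := Classical.arbitrary I
  have h01 := (h (e.symm (i, 0))).trans (h (e.symm (i, 1))).symm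
  simp [listing] at h01

theorem exists_reindex_listing_eq [Countable G] (hc : Function.Injective c) (e : ℕ ≃ G × ℕ)
    {k : A} (hk : k ∉ G) :
    ∃ z, interpolate z (c k) = 0 ∧
      ∀ (g : G) t, reindex c g (listing e z t) = listing e z (shift G (ℕ → Bool) g t) := by
  classical
  let f (a : A) (n : ℕ) : ℕ :=
    if ha : a ∈ G then e.symm ((⟨a, ha⟩ : G)⁻¹ * (e n).1, (e n).2) else 0
  obtain ⟨z, hz⟩ := exists_interpolate_eq hc
    ((Set.to_countable (G : Set A)).union (Set.countable_singleton k)) f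
  refine ⟨z, ?_, fun g t => ?_⟩
  · rw [hz k (Or.inr rfl)]
    exact funext fun n => dif_neg hk
  · have hzg : interpolate z (c g) = fun n => e.symm (g⁻¹ * (e n).1, (e n).2) := by
      rw [hz g (Or.inl g.2)]
      exact funext fun n => dif_pos g.2
    simp [reindex, listing, hzg, Function.comp_def, shift_apply]

theorem isUniversalPartialAction_reindex (hc : Function.Injective c) :
    IsUniversalPartialAction (reindex c) := by
  refine ⟨measurable_reindex c, fun G K hG hKG => ?_⟩
  obtain ⟨k, hkK, hkG⟩ := SetLike.not_le_iff_exists.1 hKG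
  obtain ⟨e⟩ : Nonempty (ℕ ≃ G × ℕ) := nonempty_equiv_of_countable
  obtain ⟨z, hzk, hz⟩ := exists_reindex_listing_eq hc e hkG
  have mem_locus (t) : listing e z t ∈ actionLocus (reindex c) G := by
    refine ⟨by simpa using hz 1 t, fun g hg h hh => ?_⟩
    have hmul := hz (⟨g, hg⟩ * ⟨h, hh⟩) t
    rw [map_mul, Equiv.Perm.mul_apply, ← hz, ← hz] at hmul
    exact hmul
  refine ⟨fun t => ⟨listing e z t, mem_locus t⟩, ⟨?_, fun g t => Subtype.ext (hz g t).symm⟩,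
    fun t ht => ?_⟩
  · have : StandardBorelSpace (actionLocus (reindex c) G) :=
      (measurableSet_actionLocus (measurable_reindex c)).standardBorel
    exact (measurableEmbedding_listing e z).measurable.subtype_mk.measurableEmbedding
      fun _ _ h => (measurableEmbedding_listing e z).injective (congrArg Subtype.val h)
  · exact not_forall_listing_eq e z t (eq_const_of_mem_actionLocus_reindex ht hkK hzk)

end Reindex

theorem uncountable_of_nullSingletonClass {X : Type*} [MeasurableSpace X] (μ : Measure X)
    [NeZero μ] [NullSingletonClass μ] : Uncountable X :=
  not_countable_iff.1 fun _ => NeZero.ne μ (Measure.measure_univ_eq_zero.1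
    (Set.countable_univ.measure_zero μ))

theorem exists_measurableEmbedding_range_null {X Z : Type*} [MeasurableSpace X]
    [StandardBorelSpace X] [Uncountable X] (μ : Measure X) [SFinite μ] [MeasurableSpace Z]
    [StandardBorelSpace Z] [Nonempty Z] :
    ∃ f : Z → X, MeasurableEmbedding f ∧ μ (Set.range f) = 0 := by
  have : Uncountable (ℕ → Bool) := by
    rw [← aleph0_lt_mk_iff]
    simp [aleph0_lt_continuum]
  have not_countable : ¬Countable (Z × (ℕ → Bool)) := fun h =>
    Uncountable.not_countable (Prod.snd_surjective (α := Z) (β := ℕ → Bool)).countable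
  let e := PolishSpace.measurableEquivOfNotCountable not_countable
    (Uncountable.not_countable (α := X))
  let f (c : ℕ → Bool) (z : Z) : X := e (z, c)
  have hf (c) : MeasurableEmbedding (f c) :=
    (e.measurable.comp (measurable_id.prodMk measurable_const)).measurableEmbedding
      fun x y h => (Prod.ext_iff.1 (e.injective h)).1
  have hdisj : Pairwise (Function.onFun Disjoint fun c => Set.range (f c)) := by
    refine fun c d hcd => Set.disjoint_left.2 ?_
    rintro _ ⟨z, rfl⟩ ⟨w, hw⟩
    exact hcd (Prod.ext_iff.1 (e.injective hw)).2.symm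
  have hcount := Measure.countable_meas_pos_of_disjoint_iUnion (μ := μ)
    (fun c => (hf c).measurableSet_range) hdisj
  by_contra! h
  refine Uncountable.not_countable (Set.countable_univ_iff.1 (hcount.mono fun c _ => ?_))
  exact pos_iff_ne_zero.2 (h (f c) (hf c))

theorem mk_autMp_le_continuum {X : Type*} [MeasurableSpace X] [StandardBorelSpace X]
    (μ : Measure X) : #(AutMp μ) ≤ 𝔠 := by
  let f (s : Gmp μ) : {f : X → X | Measurable f} := ⟨(s : Equiv.Perm X), s.2.measurable⟩
  have hf : Function.Injective f := fun s t h =>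
    Subtype.ext (DFunLike.coe_injective (congrArg Subtype.val h))
  exact (mk_le_of_surjective (QuotientGroup.mk'_surjective (Imp μ))).trans
    ((mk_le_of_injective hf).trans (mk_measurable_le_continuum X))

section NullSets

variable {X : Type*} [MeasurableSpace X] [StandardBorelSpace X] {μ : Measure X}
  {S : Subgroup (Gmp μ)} {B : Set X}

theorem exists_invariant_null_superset (hS : (S : Set (Gmp μ)).Countable) (hB : μ B = 0) :
    ∃ Y, B ⊆ Y ∧ MeasurableSet Y ∧ μ Y = 0 ∧
      ∀ s ∈ S, ∀ x, (s : Equiv.Perm X) x ∈ Y ↔ x ∈ Y := by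
  let Y : Set X := ⋃ s ∈ (S : Set (Gmp μ)), (s : Equiv.Perm X) ⁻¹' toMeasurable μ B
  have mem_Y (x : X) : x ∈ Y ↔ ∃ s ∈ S, (s : Equiv.Perm X) x ∈ toMeasurable μ B := by simp [Y]
  have apply_mem {s} (hs : s ∈ S) {x} (hx : x ∈ Y) : (s : Equiv.Perm X) x ∈ Y := by
    obtain ⟨t, ht, htx⟩ := (mem_Y x).1 hx
    exact (mem_Y _).2 ⟨t * s⁻¹, mul_mem ht (inv_mem hs), by simpa using htx⟩
  have hB' : MeasurableSet (toMeasurable μ B) := measurableSet_toMeasurable μ B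
  refine ⟨Y, fun x hx => (mem_Y x).2 ⟨1, one_mem S, subset_toMeasurable μ B hx⟩,
    .biUnion hS fun s _ => s.2.measurable hB', ?_, fun s hs x =>
      ⟨fun h => by simpa using apply_mem (inv_mem hs) h, apply_mem hs⟩⟩
  refine (measure_biUnion_null_iff hS).2 fun s _ => ?_
  rw [s.2.measure_preimage hB'.nullMeasurableSet, measure_toMeasurable, hB]

theorem exists_quotient_action_compl_null (hS : (S : Set (Gmp μ)).Countable) (hB : μ B = 0) :
    ∃ Y, B ⊆ Y ∧ MeasurableSet Y ∧ μ Y = 0 ∧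
      ∃ ρ : S.map (quotientMap μ) →* Equiv.Perm (Yᶜ : Set X), (∀ k, Measurable (ρ k)) ∧
        ∀ s (hs : s ∈ S) x,
          (ρ ⟨quotientMap μ s, Subgroup.mem_map_of_mem _ hs⟩ x : X) = (s : Equiv.Perm X) x := by
  have hSI : ((S : Set (Gmp μ)) ∩ Imp μ).Countable := hS.mono Set.inter_subset_left
  let moved : Set X := ⋃ s ∈ (S : Set (Gmp μ)) ∩ Imp μ, {x | (s : Equiv.Perm X) x ≠ x}
  have hmoved : μ moved = 0 := (measure_biUnion_null_iff hSI).2 fun s hs => hs.2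
  obtain ⟨Y, hBY, hY, hY0, hinv⟩ := exists_invariant_null_superset hS (measure_union_null hB hmoved)
  let α : S →* Equiv.Perm (Yᶜ : Set X) := restrictAction ((Gmp μ).subtype.comp S.subtype) Yᶜ
    fun s x => not_congr (hinv s s.2 x)
  have ker_le : ((quotientMap μ).subgroupMap S).ker ≤ α.ker := by
    refine fun s hs => Equiv.ext fun x => Subtype.ext ?_
    have hsI : (s : Gmp μ) ∈ Imp μ :=
      (QuotientGroup.eq_one_iff _).1 (congrArg Subtype.val (MonoidHom.mem_ker.1 hs))
    by_contra hne
    exact x.2 (hBY (Or.inr (Set.mem_biUnion ⟨s.2, hsI⟩ hne)))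
  have hsurj := (quotientMap μ).subgroupMap_surjective S
  let ρ := ((quotientMap μ).subgroupMap S).liftOfSurjective hsurj ⟨α, ker_le⟩
  have hρ (s : S) : ρ ((quotientMap μ).subgroupMap S s) = α s :=
    MonoidHom.liftOfRightInverse_comp_apply _ _ (Function.rightInverse_surjInv hsurj)
      ⟨α, ker_le⟩ s
  refine ⟨Y, Set.subset_union_left.trans hBY, hY, hY0, ρ, hsurj.forall.2 fun s => ?_,
    fun s hs x => congrArg (fun e : Equiv.Perm (Yᶜ : Set X) => (e x : X)) (hρ ⟨s, hs⟩)⟩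
  rw [hρ]
  exact (s.1.2.measurable.comp measurable_subtype_coe).subtype_mk

theorem exists_lift_of_ae_eq {K : Subgroup (AutMp μ)} {b : K →* Equiv.Perm X}
    (hb : ∀ k, Measurable (b k))
    (hae : ∀ k : K, ∃ s : Gmp μ, quotientMap μ s = k ∧ b k =ᵐ[μ] (s : Equiv.Perm X)) :
    ∃ β : K →* Gmp μ, ∀ k, (β k : Equiv.Perm X) = b k ∧ quotientMap μ (β k) = k := by
  have hmem (k : K) : b k ∈ Gmp μ := by
    obtain ⟨s, -, hs⟩ := hae k
    exact ⟨hb k, (Measure.map_congr hs).trans s.2.map_eq⟩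
  refine ⟨b.codRestrict (Gmp μ) hmem, fun k => ⟨rfl, ?_⟩⟩
  obtain ⟨s, hsk, hs⟩ := hae k
  refine (QuotientGroup.eq.2 ?_).trans hsk
  change ∀ᵐ x ∂μ, (b k)⁻¹ ((s : Equiv.Perm X) x) = x
  filter_upwards [hs] with x hx
  rw [Equiv.Perm.inv_eq_iff_eq, hx]

end NullSets

/-- A countable group of measure preserving Borel bijections that maps injectively into
`Aut(X, μ)`, hence a lift of its image there, and that acts on the reserved set `Set.range i` as
`act` prescribes, at the points where `act` obeys the laws of an action of that image. -/
structure IsPartialLift {X R : Type*} [MeasurableSpace X] [StandardBorelSpace X] {μ : Measure X}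
    (act : AutMp μ → R → R) (i : R → X) (Γ : Subgroup (Gmp μ)) : Prop where
  countable : (Γ : Set (Gmp μ)).Countable
  disjoint_ker : Disjoint Γ (quotientMap μ).ker
  apply_reserve : ∀ γ ∈ Γ, ∀ r ∈ actionLocus act (Γ.map (quotientMap μ)),
    (γ : Equiv.Perm X) (i r) = i (act (quotientMap μ γ) r)

section PartialLift

variable {X R : Type*} [MeasurableSpace X] [StandardBorelSpace X] {μ : Measure X}
  {act : AutMp μ → R → R} {i : R → X} {Γ S : Subgroup (Gmp μ)}

theorem isPartialLift_bot : IsPartialLift act i ⊥ where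
  countable := by simp
  disjoint_ker := disjoint_bot_left
  apply_reserve γ hγ r hr := by
    rw [Subgroup.mem_bot.1 hγ, map_one, hr.1]
    rfl

theorem isPartialLift_sSup {C : Set (Subgroup (Gmp μ))} (hne : C.Nonempty)
    (hcount : C.Countable) (hC : DirectedOn (· ≤ ·) C) (h : ∀ Γ ∈ C, IsPartialLift act i Γ) :
    IsPartialLift act i (sSup C) where
  countable := (hcount.biUnion fun Γ hΓ => (h Γ hΓ).countable).mono fun γ hγ => by
    simpa using (Subgroup.mem_sSup_of_directedOn hne hC).1 hγ
  disjoint_ker := disjoint_sSup_of_directedOn hne hC fun Γ hΓ => (h Γ hΓ).disjoint_ker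
  apply_reserve γ hγ r hr := by
    obtain ⟨Γ, hΓ, hγΓ⟩ := (Subgroup.mem_sSup_of_directedOn hne hC).1 hγ
    exact (h Γ hΓ).apply_reserve γ hγΓ r
      (actionLocus_anti act (Subgroup.map_mono (le_sSup hΓ)) hr)

theorem bddAbove_isPartialLift {C : Set {Γ : Subgroup (Gmp μ) // IsPartialLift act i Γ}}
    (hcount : C.Countable) (hC : IsChain (· ≤ ·) C) : BddAbove C := by
  rcases C.eq_empty_or_nonempty with rfl | hne
  · exact ⟨⟨⊥, isPartialLift_bot⟩, fun _ h => h.elim⟩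
  have hdir : DirectedOn (· ≤ ·) (Subtype.val '' C) :=
    directedOn_image.2 hC.directedOn
  have hsSup : IsPartialLift act i (sSup (Subtype.val '' C)) :=
    isPartialLift_sSup (hne.image _) (hcount.image _) hdir (Set.forall_mem_image.2 fun Γ _ => Γ.2)
  exact ⟨⟨_, hsSup⟩, fun Γ hΓ => le_sSup (Set.mem_image_of_mem Subtype.val hΓ)⟩

theorem isPartialLift_range {K : Subgroup (AutMp μ)} [Countable K] {β : K →* Gmp μ}
    (hβ : (quotientMap μ).comp β = K.subtype)
    (hres : ∀ k, ∀ r ∈ actionLocus act K, (β k : Equiv.Perm X) (i r) = i (act k r)) :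
    IsPartialLift act i β.range where
  countable := Set.countable_range β
  disjoint_ker := by
    refine Subgroup.disjoint_def.2 ?_
    rintro _ ⟨k, rfl⟩ hk
    have hk1 : k = 1 := Subtype.ext ((DFunLike.congr_fun hβ k).symm.trans hk)
    rw [hk1, map_one]
  apply_reserve := by
    rw [MonoidHom.map_range, hβ, K.range_subtype]
    rintro _ ⟨k, rfl⟩ r hr
    rw [hres k r hr]
    exact congrArg (fun k' => i (act k' r)) (DFunLike.congr_fun hβ k).symm

variable [MeasurableSpace R]

theorem IsPartialLift.isActionEmbedding_reserve [MeasurableEq R] (hΓ : IsPartialLift act i Γ)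
    (hact : ∀ a, Measurable (act a)) (hi : MeasurableEmbedding i)
    {a : Γ.map (quotientMap μ) →* Equiv.Perm X}
    (ha : ∀ γ (hγ : γ ∈ Γ), a ⟨quotientMap μ γ, Subgroup.mem_map_of_mem _ hγ⟩ = γ)
    {K : Subgroup (AutMp μ)} [Countable K] (hK : Γ.map (quotientMap μ) ≤ K) :
    IsActionEmbedding ((locusHom act K).comp (Subgroup.inclusion hK)) a (i ∘ (↑)) where
  measurableEmbedding := hi.comp (.subtype_coe (measurableSet_actionLocus hact))
  semiconj := by
    rintro ⟨_, γ, hγ, rfl⟩ r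
    exact ((congrArg (fun e : Equiv.Perm X => e (i r)) (ha γ hγ)).trans
      (hΓ.apply_reserve γ hγ r (actionLocus_anti act hK r.2))).symm

theorem IsPartialLift.exists_extend_action [MeasurableEq R] (hΓ : IsPartialLift act i Γ)
    (hact : IsUniversalPartialAction act) (hi : MeasurableEmbedding i) (hi0 : μ (Set.range i) = 0)
    (hS : (S : Set (Gmp μ)).Countable) (hΓS : Γ ≤ S)
    (hSΓ : ¬S.map (quotientMap μ) ≤ Γ.map (quotientMap μ)) :
    ∃ b : S.map (quotientMap μ) →* Equiv.Perm X, (∀ k, Measurable (b k)) ∧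
      (∀ γ (hγ : γ ∈ Γ), b ⟨quotientMap μ γ, Subgroup.mem_map_of_mem _ (hΓS hγ)⟩ = γ) ∧
      (∀ k, ∀ r ∈ actionLocus act (S.map (quotientMap μ)), b k (i r) = i (act k r)) ∧
      ∀ s (hs : s ∈ S),
        b ⟨quotientMap μ s, Subgroup.mem_map_of_mem _ hs⟩ =ᵐ[μ] (s : Equiv.Perm X) := by
  have hGK : Γ.map (quotientMap μ) ≤ S.map (quotientMap μ) := Subgroup.map_mono hΓS
  have : Countable (Γ.map (quotientMap μ)) := (hΓ.countable.image _).to_subtype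
  have : Countable (S.map (quotientMap μ)) := (hS.image _).to_subtype
  obtain ⟨σ, -, hσ⟩ := exists_section_of_disjoint_ker hΓ.disjoint_ker
  let a : Γ.map (quotientMap μ) →* Equiv.Perm X := (Gmp μ).subtype.comp σ
  have ha (γ) (hγ : γ ∈ Γ) : a ⟨quotientMap μ γ, Subgroup.mem_map_of_mem _ hγ⟩ = γ :=
    congrArg Subtype.val (hσ γ hγ)
  obtain ⟨Y, hiY, hY, hY0, ρ, hρm, hρ⟩ := exists_quotient_action_compl_null hS hi0
  obtain ⟨u, hu, hu_notMem⟩ := hact.exists_embedding (Γ.map (quotientMap μ)) _ inferInstance hSΓ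
  have off_null : IsActionEmbedding (ρ.comp (Subgroup.inclusion hGK)) a (↑) := by
    refine ⟨.subtype_coe hY.compl, ?_⟩
    rintro ⟨_, γ, hγ, rfl⟩ y
    exact (hρ γ (hΓS hγ) y).trans (congrArg (fun e : Equiv.Perm X => e y) (ha γ hγ)).symm
  have disjoint_of_subset {s : Set X} (hs : s ⊆ Set.range i) :
      Disjoint s (Set.range ((↑) : (Yᶜ : Set X) → X)) := by
    rw [Subtype.range_coe]
    exact Set.disjoint_compl_right_iff_subset.2 (hs.trans hiY)
  obtain ⟨b, hb, hba, hbr, hbY⟩ := exists_extend_action_of_disjoint_embeddings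
    (Subgroup.inclusion_injective hGK) (a := a) (fun g => (σ g).2.measurable)
    (fun k => ((hact.measurable k).comp measurable_subtype_coe).subtype_mk) hρm
    (hΓ.isActionEmbedding_reserve hact.measurable hi ha hGK) off_null
    ((hΓ.isActionEmbedding_reserve hact.measurable hi ha le_rfl).comp hu)
    (disjoint_of_subset (Set.range_comp_subset_range _ _))
    (Set.disjoint_left.2 (Set.forall_mem_range.2 fun t ⟨r, h⟩ =>
      hu_notMem t (hi.injective h ▸ r.2)))
    (disjoint_of_subset (Set.range_subset_iff.2 fun _ => ⟨_, rfl⟩))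
  refine ⟨b, hb, fun γ hγ => ?_, fun k r hr => (hbr k ⟨r, hr⟩).symm, fun s hs => ?_⟩
  · rw [← ha γ hγ, ← hba]
    rfl
  · filter_upwards [measure_eq_zero_iff_ae_notMem.1 hY0] with y hy
    exact (hbY _ ⟨y, hy⟩).symm.trans (hρ s hs ⟨y, hy⟩)

theorem IsPartialLift.exists_le [MeasurableEq R] (hΓ : IsPartialLift act i Γ)
    (hact : IsUniversalPartialAction act) (hi : MeasurableEmbedding i) (hi0 : μ (Set.range i) = 0)
    (hS : (S : Set (Gmp μ)).Countable) (hΓS : Γ ≤ S) :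
    ∃ Γ', Γ ≤ Γ' ∧ IsPartialLift act i Γ' ∧ S.map (quotientMap μ) ≤ Γ'.map (quotientMap μ) := by
  by_cases hSΓ : S.map (quotientMap μ) ≤ Γ.map (quotientMap μ)
  · exact ⟨Γ, le_rfl, hΓ, hSΓ⟩
  have : Countable (S.map (quotientMap μ)) := (hS.image _).to_subtype
  obtain ⟨b, hb, hbΓ, hres, hae⟩ := hΓ.exists_extend_action hact hi hi0 hS hΓS hSΓ
  obtain ⟨β, hβ⟩ := exists_lift_of_ae_eq hb <| by
    rintro ⟨_, s, hs, rfl⟩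
    exact ⟨s, rfl, hae s hs⟩
  have hβ' : (quotientMap μ).comp β = (S.map (quotientMap μ)).subtype :=
    MonoidHom.ext fun k => (hβ k).2
  refine ⟨β.range, fun γ hγ => ⟨⟨_, Subgroup.mem_map_of_mem _ (hΓS hγ)⟩, ?_⟩,
    isPartialLift_range hβ' fun k r hr => ?_, ?_⟩
  · exact Subtype.ext ((hβ _).1.trans (hbΓ γ hγ))
  · rw [(hβ k).1, hres k r hr]
  · rw [MonoidHom.map_range, hβ', Subgroup.range_subtype]

theorem isCofinal_mem_map [MeasurableEq R] (hact : IsUniversalPartialAction act)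
    (hi : MeasurableEmbedding i) (hi0 : μ (Set.range i) = 0) (a : AutMp μ) :
    IsCofinal {Γ : {Γ : Subgroup (Gmp μ) // IsPartialLift act i Γ} |
      a ∈ Γ.1.map (quotientMap μ)} := by
  rintro ⟨Γ, hΓ⟩
  obtain ⟨s, rfl⟩ := QuotientGroup.mk'_surjective (Imp μ) a
  have subset_closure := Subgroup.subset_closure (k := insert s (Γ : Set (Gmp μ)))
  obtain ⟨Γ', hle, hΓ', hmap⟩ := hΓ.exists_le hact hi hi0
    (countable_subgroupClosure (hΓ.countable.insert s))
    ((Set.subset_insert _ _).trans subset_closure)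
  exact ⟨⟨Γ', hΓ'⟩, hmap ⟨s, subset_closure (Set.mem_insert _ _), rfl⟩, hle⟩

end PartialLift

theorem theorem1_general (CH : Cardinal.aleph.{0} 1 = Cardinal.continuum.{0}) {X : Type*}
    [MeasurableSpace X] [StandardBorelSpace X] [Uncountable X] (μ : Measure X) [SFinite μ] :
    ∃ h : AutMp μ →* Gmp μ, (quotientMap μ).comp h = MonoidHom.id (AutMp μ) := by
  have mk_le : #(AutMp μ) ≤ ℵ₁ := by
    have CH' : (ℵ₁ : Cardinal) = 𝔠 := by simpa using congrArg Cardinal.lift CH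
    exact CH' ▸ mk_autMp_le_continuum μ
  obtain ⟨c, hc⟩ : ∃ c : AutMp μ → ℕ → Bool, Function.Injective c := by
    obtain ⟨c⟩ := lift_mk_le'.1 (by simpa using mk_autMp_le_continuum μ :
      lift.{0} #(AutMp μ) ≤ lift #(ℕ → Bool))
    exact ⟨c, c.injective⟩
  obtain ⟨i, hi, hi0⟩ := exists_measurableEmbedding_range_null (Z := ReindexSpace) μ
  obtain ⟨C, hC, hCD⟩ := exists_isChain_inter_nonempty_of_mk_le_aleph_one mk_le
    (fun C => bddAbove_isPartialLift)
    (isCofinal_mem_map (isUniversalPartialAction_reindex hc) hi hi0)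
  refine exists_comp_eq_id_of_directedOn (C := Subtype.val '' C)
    (directedOn_image.2 hC.directedOn) ?_ fun a => ?_
  · rintro _ ⟨Γ, -, rfl⟩
    exact Γ.2.disjoint_ker
  · obtain ⟨Γ, hΓC, ha⟩ := hCD a
    exact ⟨Γ, Set.mem_image_of_mem _ hΓC, ha⟩

/-- Under the continuum hypothesis, the identity automorphism of `Aut(X, μ)` splits over
the canonical homomorphism `G_mp(X, μ) → Aut(X, μ)`, for every standard non-atomic Borel
probability space `(X, μ)`. -/
theorem theorem1 (CH : Cardinal.aleph.{0} 1 = Cardinal.continuum.{0})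
    {X : Type*} [MeasurableSpace X] [StandardBorelSpace X]
    (μ : MeasureTheory.Measure X) [MeasureTheory.IsProbabilityMeasure μ]
    [MeasureTheory.NullSingletonClass μ] :
    ∃ h : AutMp μ →* Gmp μ, (quotientMap μ).comp h = MonoidHom.id (AutMp μ) := by
  have := uncountable_of_nullSingletonClass μ
  exact theorem1_general CH μ
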